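/- Conventions: $\hat f(\xi)=\int_{\mathbb R}e^{-i\xi x}f(x)\,dx$, extended to $L^2(\mathbb R)$; $w(x)=1+|x|$; $L^p_s(\mathbb R)=\{f: w^sf\in L^p(\mathbb R)\}$; $H^s_s(\mathbb R)=\{f: f\in L^2_s(\mathbb R),\ \hat f\in L^2_s(\mathbb R)\}$; $C_+$ is the Cauchy projection, $\widehat{C_+f}=\chi_{(0,\infty)}\hat f$. For $k\in\mathbb C\setminus[0,\infty)$ let $$G_k(x)=\frac1{2\pi}\int_0^\infty\frac{e^{ix\xi}}{\xi-k}\,d\xi ,$$ i.e. the inverse Fourier transform of the $L^2$ function $\chi_{(0,\infty)}(\xi)/(\xi-k)$. For $u\in L^2_s(\mathbb R)$ with $s>\frac12$, the Jost function $m_1(\cdot,k)$ is the solution of $$m_1=1+G_k*(u\,m_1)\quad\text{a.e. on }\mathbb R$$ that belongs to $L^\infty_{-(s-s_1)}(\mathbb R)$ for some $s_1$ with $\frac12<s_1<s$. Theorem. Let $s>\frac12$, let $u\in H^s_s(\mathbb R)$ (possibly complex-valued), and let $\alpha\in(0,\frac\pi2)$. Then there exist $\varepsilon>0$, $C>0$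 and $k_0>0$ such that for every $k\in\mathbb C$ with $$|\operatorname{Im}k|>(\tan\alpha)\operatorname{Re}k\qquad\text{and}\qquad|k|>k_0,$$ the Jost function $m_1(\cdot,k)$ exists, is unique (up to equality almost everywhere), and satisfies $$\Big\|\,m_1(\cdot,k)-\Big(1-\frac{C_+u}{k}\Big)\Big\|_{L^\infty(\mathbb R)}\le\frac{C}{|k|^{1+\varepsilon}} .$$ In other words, $m_1(x,k)=1-\frac{C_+u(x)}{k}+O(|k|^{-1-\varepsilon})$ in $L^\infty(\mathbb R)$ as $k\to\infty$ in the sector $|\operatorname{Im}k|>(\tan\alpha)\operatorname{Re}k$. -/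

import Mathlib

open MeasureTheory Set
open scoped FourierTransform ENNReal

noncomputable section

namespace BenjaminOno

/-- The Fourier transform `f̂(ξ) = ∫ e^{-iξx} f(x) dx` of a function `f ∈ L²(ℝ)`, in the sense of
Plancherel. Mathlib's Fourier transform `𝓕` uses the character `e^{-2πiξx}`, so that
`f̂(ξ) = 𝓕 f (ξ / 2π)`. (Value `0` if `f ∉ L²`.) -/
def fourierL2 (f : ℝ → ℂ) : ℝ → ℂ := by
  classical
  exact if h : MemLp f 2 volume then
    fun ξ => (𝓕 (h.toLp f) : Lp ℂ 2 (volume : Measure ℝ)) (ξ / (2 * Real.pi))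
  else 0

/-- The inverse Fourier transform `f̌(x) = (1 / 2π) ∫ e^{ixξ} f(ξ) dξ` of a function `f ∈ L²(ℝ)`,
in the sense of Plancherel. By the substitution `ξ = 2πη` it is Mathlib's inverse Fourier transform
of `η ↦ f(2πη)`. (Value `0` if `f ∉ L²`.) -/
def fourierInvL2 (f : ℝ → ℂ) : ℝ → ℂ := by
  classical
  exact if h : MemLp (fun η : ℝ => f (2 * Real.pi * η)) 2 volume then
    fun x => (𝓕⁻ (h.toLp (fun η : ℝ => f (2 * Real.pi * η))) : Lp ℂ 2 (volume : Measure ℝ)) x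
  else 0

/-- The weight `w(x) = 1 + |x|`. -/
def weight (x : ℝ) : ℝ := 1 + |x|

/-- `f` belongs to the weighted space `L^p_s(ℝ)`, i.e. `w^s f ∈ L^p(ℝ)`. -/
def MemWeightedLp (p : ℝ≥0∞) (s : ℝ) (f : ℝ → ℂ) : Prop :=
  MemLp (fun x : ℝ => ((weight x ^ s : ℝ) : ℂ) * f x) p volume

/-- `f` belongs to the weighted Sobolev space `H^s_s(ℝ)` (for `s ≥ 0`): `f ∈ L²_s` and
`f̂ ∈ L²_s`. -/
def MemWeightedSobolev (s : ℝ) (f : ℝ → ℂ) : Prop :=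
  MemWeightedLp 2 s f ∧ MemWeightedLp 2 s (fourierL2 f)

/-- The Cauchy projection `C₊` on `L²(ℝ)`: the Fourier transform of `C₊ f` is `χ_{ℝ₊} f̂`. -/
def cauchyPlus (f : ℝ → ℂ) : ℝ → ℂ :=
  fourierInvL2 ((Ioi (0 : ℝ)).indicator (fourierL2 f))

/-- The kernel `G_k(x) = (1 / 2π) ∫_0^∞ e^{ixξ} / (ξ - k) dξ`, for `k ∈ ℂ \ [0, ∞)`. The integral
does not converge absolutely; `G_k` is the inverse Fourier transform of the `L²` function
`χ_{ℝ₊}(ξ) / (ξ - k)`. -/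
def kernelG (k : ℂ) : ℝ → ℂ :=
  fourierInvL2 ((Ioi (0 : ℝ)).indicator (fun ξ : ℝ => 1 / ((ξ : ℂ) - k)))

/-- The operator `T_k φ = G_k * (u φ)`. -/
def opT (u : ℝ → ℂ) (k : ℂ) (φ : ℝ → ℂ) : ℝ → ℂ :=
  fun x => ∫ y : ℝ, kernelG k (x - y) * (u y * φ y)

/-- `m` is a Jost function `m₁(·, k)` for the potential `u ∈ L²_s(ℝ)`: it belongs to the space
`L^∞_{-(s - s₁)}(ℝ)` for some `1/2 < s₁ < s` and solves `m = 1 + G_k * (u m)` (as an identity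
between elements of that space, i.e. almost everywhere). -/
structure IsJostSolution (s : ℝ) (u : ℝ → ℂ) (k : ℂ) (m : ℝ → ℂ) : Prop where
  mem_space : ∃ s₁ : ℝ, 1 / 2 < s₁ ∧ s₁ < s ∧ MemWeightedLp ∞ (-(s - s₁)) m
  integral_eq : ∀ᵐ x : ℝ, m x = 1 + opT u k m x

end BenjaminOno

end

/-! Write `T φ = G_k * (u φ)`. Cauchy–Schwarz gives `‖T φ‖_∞ ≤ ‖G_k‖₂ ‖w^s u‖₂ ‖w^{-s} φ‖_∞`
(`norm_opT_le`). By Plancherel `‖G_k‖₂` is the norm of the symbol `1/(ξ - k)` on the half-line, and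
in the sector `|ξ - k|` dominates `ξ + |k|`, so `‖G_k‖₂ = O(|k|^{-1/4})`. For large `|k|`, `T` is a
contraction with ratio `1/2`: a bounded solution exists, and any solution in a weighted space is
bounded and equal to it.

From `m - 1 = T 1 + T (m - 1)` follows `‖m - 1‖_∞ ≤ 2 ‖T 1‖_∞`, hence `m - 1 - T 1 = T (m - 1) =
O(|k|^{-1/4} ‖T 1‖_∞)`. On the Fourier side `T 1` has symbol `û(ξ)/(ξ - k)` on `ξ > 0`, while
`-C₊u/k` has `-û(ξ)/k`. Since `û ∈ L²_s`, `w^θ û` is integrable for `θ < s - 1/2`. Thus `T 1 =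
O(1/|k|)` and `T 1 + C₊u/k = O(|k|^{-1-θ})` (`norm_opT_one_add_cauchyPlus_le`). -/

namespace BenjaminOno

/-! ### Fourier inversion and pairings in `L²` -/

theorem integral_fourier_mul_eq_flip {f g : ℝ → ℂ} (hf : Integrable f) (hg : Integrable g) :
    ∫ ξ, 𝓕 f ξ * g ξ = ∫ x, f x * 𝓕 g x := by
  have := VectorFourier.integral_fourierIntegral_smul_eq_flip (L := innerₗ ℝ)
      Real.continuous_fourierChar continuous_inner hf hg
  simpa only [smul_eq_mul, flip_innerₗ] using! this

theorem integral_fourierInv_mul_eq_flip {f g : ℝ → ℂ} (hf : Integrable f) (hg : Integrable g) :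
    ∫ ξ, 𝓕⁻ f ξ * g ξ = ∫ x, f x * 𝓕⁻ g x := by
  simp only [Real.fourierInv_eq_fourier_comp_neg f, Real.fourierInv_eq_fourier_neg g]
  rw [integral_fourier_mul_eq_flip hf.comp_neg hg, ← integral_neg_eq_self]
  simp

/-- On `L¹ ∩ L²` the inverse Fourier transform in the sense of Plancherel is the integral. -/
theorem fourierInv_toLp_ae_eq {f : ℝ → ℂ} (h1 : Integrable f) (h2 : MemLp f 2 volume) :
    ((𝓕⁻ (h2.toLp f) : Lp ℂ 2 (volume : Measure ℝ)) : ℝ → ℂ) =ᵐ[volume] 𝓕⁻ f := by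
  have hcont : Continuous (𝓕⁻ f) := by
    have : 𝓕⁻ f = 𝓕 (fun x => f (-x)) := Real.fourierInv_eq_fourier_comp_neg f
    rw [this]
    exact VectorFourier.fourierIntegral_continuous Real.continuous_fourierChar
      continuous_inner h1.comp_neg
  -- Test both sides against smooth compactly supported `g`; the transform moves onto `g`, a
  -- Schwartz function, where the `L¹` formula applies.
  refine ae_eq_of_integral_contDiff_smul_eq
    ((Lp.memLp _).locallyIntegrable (by norm_num)) hcont.locallyIntegrable ?_
  intro g hg hgc
  have hc : HasCompactSupport (fun x => (g x : ℂ)) := hgc.comp_left (g := fun r : ℝ => (r : ℂ)) rfl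
  let φ : SchwartzMap ℝ ℂ := hc.toSchwartzMap (Complex.ofRealCLM.contDiff.comp hg)
  have hφ : ∀ x, φ x = (g x : ℂ) := fun x => rfl
  have key := congrArg (fun T => T φ) (Lp.fourierInv_toTemperedDistribution_eq (h2.toLp f))
  simp only [TemperedDistribution.fourierInv_apply, Lp.toTemperedDistribution_apply] at key
  have e1 : ∫ x, g x • (𝓕⁻ (h2.toLp f) : Lp ℂ 2 (volume : Measure ℝ)) x =
      ∫ x, φ x • (𝓕⁻ (h2.toLp f) : Lp ℂ 2 (volume : Measure ℝ)) x := by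
    simp [hφ]
  rw [e1, ← key]
  have e2 : ∫ x, (𝓕⁻ φ) x • (h2.toLp f) x = ∫ x, (𝓕⁻ φ) x • f x := by
    apply integral_congr_ae
    filter_upwards [h2.coeFn_toLp] with x hx
    rw [hx]
  rw [e2, SchwartzMap.fourierInv_coe]
  simp only [smul_eq_mul]
  rw [integral_fourierInv_mul_eq_flip φ.integrable h1]
  simp [hφ]

/-- Translation turns into modulation, so the multiplication formula absorbs the shift by `x`. -/
theorem fourierInv_sub_eq (a : ℝ → ℂ) (x y : ℝ) :
    𝓕⁻ a (x - y) = 𝓕 (fun ξ => (Real.fourierChar (ξ * x) : ℂ) * a ξ) y := by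
  rw [Real.fourierInv_eq', Real.fourier_eq']
  congr 1; ext ξ
  rw [Real.fourierChar_apply, smul_eq_mul, smul_eq_mul, ← mul_assoc, ← Complex.exp_add]
  congr 2
  simp
  ring

theorem memLp_fourierChar_mul {p : ℝ≥0∞} {a : ℝ → ℂ} (ha : MemLp a p volume) (x : ℝ) :
    MemLp (fun ξ => (Real.fourierChar (ξ * x) : ℂ) * a ξ) p volume := by
  refine ha.of_le ?_ (Filter.Eventually.of_forall fun ξ => by rw [norm_mul, Circle.norm_coe, one_mul])
  refine Continuous.aestronglyMeasurable ?_ |>.mul ha.1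
  exact continuous_subtype_val.comp (Real.continuous_fourierChar.comp (continuous_id.mul continuous_const))

theorem memLp_comp_const_sub {p : ℝ≥0∞} {a : ℝ → ℂ} (ha : MemLp a p volume) (x : ℝ) :
    MemLp (fun y => a (x - y)) p volume :=
  ha.comp_measurePreserving (Measure.measurePreserving_sub_left volume x)

/-- `v ↦ ∫ b v` is continuous on `L²`. -/
theorem continuous_integral_mul {b : ℝ → ℂ} (hb : MemLp b 2 volume) :
    Continuous (fun v : Lp ℂ 2 (volume : Measure ℝ) => ∫ y, b y * v y) := by
  have h : (fun v : Lp ℂ 2 (volume : Measure ℝ) => ∫ y, b y * v y) =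
      fun v => (ContinuousLinearMap.mul ℂ ℂ).lpPairing volume 2 2 (hb.toLp b) v := by
    ext v
    rw [ContinuousLinearMap.lpPairing_eq_integral]
    apply integral_congr_ae
    filter_upwards [hb.coeFn_toLp] with y hy
    simp [hy]
  rw [h]
  exact ContinuousLinearMap.continuous _

/-- The `L²` pairing against translates of an inverse Fourier transform. -/
theorem integral_fourierInv_sub_mul (a u : Lp ℂ 2 (volume : Measure ℝ)) (x : ℝ) :
    ∫ y, (𝓕⁻ a : Lp ℂ 2 (volume : Measure ℝ)) (x - y) * u y =
      ∫ ξ, (Real.fourierChar (ξ * x) : ℂ) * a ξ * (𝓕 u : Lp ℂ 2 (volume : Measure ℝ)) ξ := by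
  have hcF := FourierTransform.continuous_fourier (E := Lp ℂ 2 (volume : Measure ℝ))
    (F := Lp ℂ 2 (volume : Measure ℝ))
  have hcI := FourierTransform.continuous_fourierInv (E := Lp ℂ 2 (volume : Measure ℝ))
    (F := Lp ℂ 2 (volume : Measure ℝ))
  -- Both sides are `L²`-continuous in `u` and in `a` separately, so two density arguments reduce
  -- the identity to Schwartz functions.
  refine DenseRange.induction_on (p := fun u : Lp ℂ 2 (volume : Measure ℝ) =>
    ∫ y, (𝓕⁻ a : Lp ℂ 2 (volume : Measure ℝ)) (x - y) * u y =
      ∫ ξ, (Real.fourierChar (ξ * x) : ℂ) * a ξ * (𝓕 u : Lp ℂ 2 (volume : Measure ℝ)) ξ)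
    (SchwartzMap.denseRange_toLpCLM (p := 2) ENNReal.ofNat_ne_top) u ?_ ?_
  · exact isClosed_eq (continuous_integral_mul (memLp_comp_const_sub (Lp.memLp _) x))
      ((continuous_integral_mul (memLp_fourierChar_mul (Lp.memLp a) x)).comp hcF)
  intro v
  simp only [SchwartzMap.toLpCLM_apply, SchwartzMap.toLp_fourier_eq]
  refine DenseRange.induction_on (p := fun a : Lp ℂ 2 (volume : Measure ℝ) =>
    ∫ y, (𝓕⁻ a : Lp ℂ 2 (volume : Measure ℝ)) (x - y) * v.toLp 2 volume y =
      ∫ ξ, (Real.fourierChar (ξ * x) : ℂ) * a ξ * (𝓕 v).toLp 2 volume ξ)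
    (SchwartzMap.denseRange_toLpCLM (p := 2) ENNReal.ofNat_ne_top) a ?_ ?_
  · refine isClosed_eq ?_ ?_
    · have h : ∀ w : Lp ℂ 2 (volume : Measure ℝ), ∫ y, w (x - y) * v.toLp 2 volume y =
          ∫ y, v.toLp 2 volume (x - y) * w y := by
        intro w
        rw [← integral_sub_left_eq_self _ volume x]
        simp [mul_comm]
      simp only [h]
      exact (continuous_integral_mul (memLp_comp_const_sub (Lp.memLp _) x)).comp hcI
    · have h : ∀ w : Lp ℂ 2 (volume : Measure ℝ),
          ∫ ξ, (Real.fourierChar (ξ * x) : ℂ) * w ξ * (𝓕 v).toLp 2 volume ξ =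
          ∫ ξ, ((Real.fourierChar (ξ * x) : ℂ) * (𝓕 v).toLp 2 volume ξ) * w ξ := by
        intro w
        congr 1; ext ξ; ring
      simp only [h]
      exact continuous_integral_mul (memLp_fourierChar_mul (Lp.memLp _) x)
  intro b
  simp only [SchwartzMap.toLpCLM_apply, SchwartzMap.toLp_fourierInv_eq]
  have hi : Integrable (fun ξ => (Real.fourierChar (ξ * x) : ℂ) * b ξ) :=
    memLp_one_iff_integrable.1 (memLp_fourierChar_mul (memLp_one_iff_integrable.2 b.integrable) x)
  have e1 : ∫ y, (𝓕⁻ b).toLp 2 volume (x - y) * v.toLp 2 volume y =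
      ∫ y, 𝓕 (fun ξ => (Real.fourierChar (ξ * x) : ℂ) * b ξ) y * v y := by
    apply integral_congr_ae
    filter_upwards [(Measure.measurePreserving_sub_left volume x).quasiMeasurePreserving.ae
      ((𝓕⁻ b).coeFn_toLp 2 volume), v.coeFn_toLp 2 volume] with y h1 h2
    rw [h1, h2, SchwartzMap.fourierInv_coe, fourierInv_sub_eq]
  have e2 : ∫ ξ, (Real.fourierChar (ξ * x) : ℂ) * b.toLp 2 volume ξ * (𝓕 v).toLp 2 volume ξ =
      ∫ ξ, ((Real.fourierChar (ξ * x) : ℂ) * b ξ) * 𝓕 (v : ℝ → ℂ) ξ := by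
    apply integral_congr_ae
    filter_upwards [b.coeFn_toLp 2 volume, (𝓕 v).coeFn_toLp 2 volume] with y h1 h2
    rw [h1, h2, SchwartzMap.fourier_coe]
  rw [e1, e2, integral_fourier_mul_eq_flip hi v.integrable]

/-! ### Weights and the Cauchy–Schwarz bound -/

theorem one_le_weight (x : ℝ) : 1 ≤ weight x := by
  unfold weight; linarith [abs_nonneg x]

theorem weight_pos (x : ℝ) : 0 < weight x := zero_lt_one.trans_le (one_le_weight x)

theorem continuous_weight_rpow (r : ℝ) : Continuous (fun x => weight x ^ r) := by
  refine Continuous.rpow_const (by unfold weight; fun_prop) fun x => Or.inl (weight_pos x).ne'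

theorem norm_weight_rpow (r x : ℝ) : ‖((weight x ^ r : ℝ) : ℂ)‖ = weight x ^ r := by
  rw [Complex.norm_real, Real.norm_of_nonneg (Real.rpow_nonneg (weight_pos x).le r)]

theorem MemWeightedLp.aestronglyMeasurable {p : ℝ≥0∞} {s : ℝ} {f : ℝ → ℂ}
    (hf : MemWeightedLp p s f) : AEStronglyMeasurable f volume := by
  have h := ((Complex.continuous_ofReal.comp
    (continuous_weight_rpow (-s))).aestronglyMeasurable (μ := volume)).mul hf.1
  refine h.congr (Filter.Eventually.of_forall fun x => ?_)
  simp only [Pi.mul_apply, Function.comp_apply]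
  rw [← mul_assoc, ← Complex.ofReal_mul, ← Real.rpow_add (weight_pos x)]
  simp

theorem MemWeightedLp.memLp {p : ℝ≥0∞} {s : ℝ} {f : ℝ → ℂ} (hs : 0 ≤ s)
    (hf : MemWeightedLp p s f) : MemLp f p volume := by
  refine MemLp.of_le hf hf.aestronglyMeasurable (Filter.Eventually.of_forall fun x => ?_)
  rw [norm_mul, norm_weight_rpow]
  exact le_mul_of_one_le_left (norm_nonneg _) (Real.one_le_rpow (one_le_weight x) hs)

/-- Cauchy–Schwarz for the integral of a product. -/
theorem norm_integral_mul_le {f g : ℝ → ℂ} (hf : MemLp f 2 volume) (hg : MemLp g 2 volume) :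
    ‖∫ y, f y * g y‖ ≤ (eLpNorm f 2 volume).toReal * (eLpNorm g 2 volume).toReal := by
  have h0 : eLpNorm (fun y => f y * g y) 1 volume ≤ eLpNorm f 2 volume * eLpNorm g 2 volume := by
    have h := eLpNorm_smul_le_mul_eLpNorm (𝕜 := ℂ) (p := 2) (q := 2) (r := 1) hg.1 hf.1
    have e : (fun y => f y * g y) = f • g := rfl
    rw [e]
    exact h
  have h1 : ‖∫ y, f y * g y‖ₑ ≤ eLpNorm f 2 volume * eLpNorm g 2 volume := by
    refine (enorm_integral_le_lintegral_enorm _).trans ?_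
    rw [← eLpNorm_one_eq_lintegral_enorm]
    exact h0
  rw [← ENNReal.toReal_mul]
  have := ENNReal.toReal_mono (ENNReal.mul_ne_top hf.2.ne hg.2.ne) h1
  simpa using this

/-- The bound for the norm of `T_k` from `L^∞_{-s}` to `L^∞`. -/
noncomputable def opTBound (s : ℝ) (u : ℝ → ℂ) (k : ℂ) : ℝ :=
  (eLpNorm (kernelG k) 2 volume).toReal *
    (eLpNorm (fun x : ℝ => ((weight x ^ s : ℝ) : ℂ) * u x) 2 volume).toReal

theorem opTBound_nonneg (s : ℝ) (u : ℝ → ℂ) (k : ℂ) : 0 ≤ opTBound s u k := by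
  unfold opTBound; positivity

theorem memLp_kernelG (k : ℂ) : MemLp (kernelG k) 2 volume := by
  unfold kernelG fourierInvL2
  split_ifs with h
  · exact Lp.memLp _
  · exact MemLp.zero

/-! ### The operator `T_k` as a contraction -/

section

variable {s : ℝ} {u : ℝ → ℂ} {k : ℂ} {φ ψ : ℝ → ℂ} {M : ℝ}

theorem norm_mul_le_of_weight {y : ℝ} (h : ‖φ y‖ ≤ M * weight y ^ s) :
    ‖u y * φ y‖ ≤ M * ‖((weight y ^ s : ℝ) : ℂ) * u y‖ := by
  rw [norm_mul, norm_mul, norm_weight_rpow]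
  nlinarith [norm_nonneg (u y)]

theorem memLp_mul_of_weight (hu : MemWeightedLp 2 s u) (hφ : AEStronglyMeasurable φ volume)
    (hM : ∀ᵐ y, ‖φ y‖ ≤ M * weight y ^ s) : MemLp (fun y => u y * φ y) 2 volume :=
  MemLp.of_le_mul hu (hu.aestronglyMeasurable.mul hφ)
    (hM.mono fun _ hy => norm_mul_le_of_weight hy)

theorem integrable_opT (hu : MemWeightedLp 2 s u) (hφ : AEStronglyMeasurable φ volume)
    (hM : ∀ᵐ y, ‖φ y‖ ≤ M * weight y ^ s) (x : ℝ) :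
    Integrable (fun y => kernelG k (x - y) * (u y * φ y)) :=
  memLp_one_iff_integrable.1 (MemLp.mul' (p := 2) (q := 2) (memLp_mul_of_weight hu hφ hM)
    (memLp_comp_const_sub (memLp_kernelG k) x))

/-- The weight passes from `φ` to `u`, and translation invariance of `‖G_k‖₂` makes the bound
uniform in `x`. The hypothesis `hM` encodes `‖w^{-s} φ‖_∞ ≤ M`. -/
theorem norm_opT_le (hu : MemWeightedLp 2 s u) (hφ : AEStronglyMeasurable φ volume) (hM0 : 0 ≤ M)
    (hM : ∀ᵐ y, ‖φ y‖ ≤ M * weight y ^ s) (x : ℝ) :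
    ‖opT u k φ x‖ ≤ opTBound s u k * M := by
  refine (norm_integral_mul_le (memLp_comp_const_sub (memLp_kernelG k) x)
    (memLp_mul_of_weight hu hφ hM)).trans ?_
  have h1 : eLpNorm (fun y => kernelG k (x - y)) 2 volume = eLpNorm (kernelG k) 2 volume :=
    eLpNorm_comp_measurePreserving (memLp_kernelG k).1 (Measure.measurePreserving_sub_left volume x)
  have h2 : eLpNorm (fun y => u y * φ y) 2 volume ≤
      ENNReal.ofReal M * eLpNorm (fun x : ℝ => ((weight x ^ s : ℝ) : ℂ) * u x) 2 volume :=
    eLpNorm_le_mul_eLpNorm_of_ae_le_mul (hM.mono fun _ hy => norm_mul_le_of_weight hy) 2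
  have h3 := ENNReal.toReal_mono (ENNReal.mul_ne_top ENNReal.ofReal_ne_top hu.2.ne) h2
  rw [ENNReal.toReal_mul, ENNReal.toReal_ofReal hM0] at h3
  rw [h1, opTBound, mul_assoc]
  refine mul_le_mul_of_nonneg_left ?_ ENNReal.toReal_nonneg
  linarith

theorem opT_congr (h : φ =ᵐ[volume] ψ) : opT u k φ = opT u k ψ := by
  ext x
  refine integral_congr_ae (h.mono fun y hy => ?_)
  simp only [hy]

theorem opT_sub {M' : ℝ} (hu : MemWeightedLp 2 s u) (hφ : AEStronglyMeasurable φ volume)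
    (hM : ∀ᵐ y, ‖φ y‖ ≤ M * weight y ^ s) (hψ : AEStronglyMeasurable ψ volume)
    (hM' : ∀ᵐ y, ‖ψ y‖ ≤ M' * weight y ^ s) (x : ℝ) :
    opT u k (fun y => φ y - ψ y) x = opT u k φ x - opT u k ψ x := by
  unfold opT
  rw [← integral_sub (integrable_opT hu hφ hM x) (integrable_opT hu hψ hM' x)]
  congr 1; ext y; ring

theorem aestronglyMeasurable_opT (hu : AEStronglyMeasurable u volume)
    (hφ : AEStronglyMeasurable φ volume) : AEStronglyMeasurable (opT u k φ) volume := by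
  have h := AEStronglyMeasurable.convolution_integrand (ContinuousLinearMap.mul ℂ ℂ)
    (μ := (volume : Measure ℝ)) (ν := volume) (hu.mul hφ) (memLp_kernelG k).1
  refine (h.integral_prod_right').congr (Filter.Eventually.of_forall fun x => ?_)
  simp only [opT, ContinuousLinearMap.mul_apply', Pi.mul_apply]
  congr 1; ext y; ring

theorem le_mul_weight_of_le (hs : 0 ≤ s) {r : ℝ} (hM : 0 ≤ M) (h : r ≤ M) (y : ℝ) :
    r ≤ M * weight y ^ s :=
  h.trans (le_mul_of_one_le_right hM (Real.one_le_rpow (one_le_weight y) hs))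

theorem ae_norm_le_toReal_eLpNorm_top (hφ : MemLp φ ∞ volume) :
    ∀ᵐ y, ‖φ y‖ ≤ (eLpNorm φ ∞ volume).toReal := by
  filter_upwards [enorm_ae_le_eLpNormEssSup φ volume] with y hy
  rw [← eLpNorm_exponent_top] at hy
  have := ENNReal.toReal_mono hφ.2.ne hy
  rwa [toReal_enorm] at this

theorem toReal_eLpNorm_top_le (hM0 : 0 ≤ M) (hM : ∀ᵐ y, ‖φ y‖ ≤ M) :
    (eLpNorm φ ∞ volume).toReal ≤ M := by
  refine ENNReal.toReal_le_of_le_ofReal hM0 ?_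
  rw [eLpNorm_exponent_top]
  exact eLpNormEssSup_le_of_ae_bound hM

/-- A function in `L^∞_{-s}` bounded by `A` plus its image under the contraction `T_k` is bounded
by `2A`. -/
theorem ae_norm_le_two_mul_of_le_add_opT (hs : 0 ≤ s) (hu : MemWeightedLp 2 s u)
    (hN : opTBound s u k ≤ 1 / 2) {A : ℝ} (hA : 0 ≤ A) (hφ : AEStronglyMeasurable φ volume)
    (hM0 : 0 ≤ M) (hM : ∀ᵐ y, ‖φ y‖ ≤ M * weight y ^ s)
    (h : ∀ᵐ y, ‖φ y‖ ≤ A + ‖opT u k φ y‖) : ∀ᵐ y, ‖φ y‖ ≤ 2 * A := by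
  -- One application of `T_k` removes the weight, so the sup norm `S` is finite and `S ≤ A + S / 2`
  -- can be absorbed.
  have hb : ∀ᵐ y, ‖φ y‖ ≤ A + opTBound s u k * M :=
    h.mono fun y hy => hy.trans (by linarith [norm_opT_le (k := k) hu hφ hM0 hM y])
  have hL : MemLp φ ∞ volume := memLp_top_of_bound hφ _ hb
  set S := (eLpNorm φ ∞ volume).toReal with hS
  have hS0 : 0 ≤ S := ENNReal.toReal_nonneg
  have h1 : ∀ᵐ y, ‖φ y‖ ≤ S := ae_norm_le_toReal_eLpNorm_top hL
  have h2 : ∀ᵐ y, ‖φ y‖ ≤ A + opTBound s u k * S :=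
    h.mono fun y hy => hy.trans (by
      linarith [norm_opT_le (k := k) hu hφ hS0 (h1.mono fun y hy => le_mul_weight_of_le hs hS0 hy y) y])
  have hN0 := opTBound_nonneg s u k
  have h3 : S ≤ A + opTBound s u k * S := toReal_eLpNorm_top_le (by positivity) h2
  have : S ≤ 2 * A := by nlinarith
  exact h1.mono fun y hy => hy.trans this

/-- Banach's fixed point theorem for `φ ↦ 1 + T_k φ` on the unweighted space `L^∞`. -/
theorem exists_bounded_fixedPoint (hs : 0 ≤ s) (hu : MemWeightedLp 2 s u)
    (hN : opTBound s u k ≤ 1 / 2) :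
    ∃ (m : ℝ → ℂ) (B : ℝ), AEStronglyMeasurable m volume ∧ 0 ≤ B ∧ (∀ᵐ x, ‖m x‖ ≤ B) ∧
      ∀ᵐ x, m x = 1 + opT u k m x := by
  have hnorm : ∀ φ : Lp ℂ ∞ (volume : Measure ℝ), ∀ᵐ y, ‖φ y‖ ≤ ‖φ‖ := by
    intro φ
    rw [Lp.norm_def]
    exact ae_norm_le_toReal_eLpNorm_top (Lp.memLp φ)
  have hbd : ∀ φ : Lp ℂ ∞ (volume : Measure ℝ), ∀ᵐ y, ‖φ y‖ ≤ ‖φ‖ * weight y ^ s := by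
    intro φ
    filter_upwards [hnorm φ] with y hy
    exact le_mul_weight_of_le hs (norm_nonneg _) hy y
  have hmem : ∀ φ : Lp ℂ ∞ (volume : Measure ℝ),
      MemLp (fun x => 1 + opT u k φ x) ∞ volume := by
    intro φ
    refine memLp_top_of_bound (aestronglyMeasurable_const.add
      (aestronglyMeasurable_opT hu.aestronglyMeasurable (Lp.aestronglyMeasurable φ)))
      (1 + opTBound s u k * ‖φ‖) (Filter.Eventually.of_forall fun x => ?_)
    refine (norm_add_le _ _).trans ?_
    rw [norm_one]
    linarith [norm_opT_le (k := k) hu (Lp.aestronglyMeasurable φ) (norm_nonneg _) (hbd φ) x]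
  let Φ : Lp ℂ ∞ (volume : Measure ℝ) → Lp ℂ ∞ (volume : Measure ℝ) := fun φ => (hmem φ).toLp _
  have hΦ : ContractingWith (1 / 2) Φ := by
    refine ⟨by norm_num, LipschitzWith.of_dist_le_mul fun φ ψ => ?_⟩
    rw [dist_eq_norm, dist_eq_norm, Lp.norm_def (Φ φ - Φ ψ)]
    refine toReal_eLpNorm_top_le (by positivity) ?_
    filter_upwards [Lp.coeFn_sub (Φ φ) (Φ ψ), (hmem φ).coeFn_toLp, (hmem ψ).coeFn_toLp]
      with x h1 h2 h3
    have e : (Φ φ - Φ ψ : Lp ℂ ∞ (volume : Measure ℝ)) x = opT u k (φ - ψ : Lp ℂ ∞ _) x := by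
      rw [h1, Pi.sub_apply, h2, h3, opT_congr (Lp.coeFn_sub φ ψ)]
      have := opT_sub (k := k) hu (Lp.aestronglyMeasurable φ) (hbd φ) (Lp.aestronglyMeasurable ψ)
        (hbd ψ) x
      rw [add_sub_add_left_eq_sub, ← this]
      rfl
    rw [e]
    refine (norm_opT_le hu (Lp.aestronglyMeasurable _) (norm_nonneg _) (hbd _) x).trans ?_
    simp only [NNReal.coe_div, NNReal.coe_one, NNReal.coe_ofNat]
    exact mul_le_mul_of_nonneg_right hN (norm_nonneg _)
  obtain ⟨m, hm⟩ : ∃ m, Φ m = m := ⟨_, hΦ.fixedPoint_isFixedPt⟩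
  refine ⟨m, ‖m‖, Lp.aestronglyMeasurable m, norm_nonneg _, hnorm m, ?_⟩
  have := (hmem m).coeFn_toLp
  filter_upwards [this] with x hx
  rw [← hx]
  exact congrArg (fun f : Lp ℂ ∞ (volume : Measure ℝ) => f x) hm.symm

end

/-! ### Resolvent symbol in the sector and decay of `‖G_k‖₂` -/

/-- In the sector `|Im k| > tan α Re k` the distance from `k` to `ξ ≥ 0` is comparable with
`ξ + |k|`. -/
theorem exists_add_norm_le_mul_norm_sub {t : ℝ} (ht : 0 < t) :
    ∃ D : ℝ, 0 < D ∧ ∀ k : ℂ, t * k.re < |k.im| → ∀ ξ : ℝ, 0 ≤ ξ → ξ + ‖k‖ ≤ D * ‖(ξ : ℂ) - k‖ := by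
  have ht' : 0 < t⁻¹ := inv_pos.2 ht
  refine ⟨2 * (1 + t⁻¹) + 1, by positivity, fun k hk ξ hξ => ?_⟩
  have h1 : ‖k‖ ≤ (1 + t⁻¹) * ‖(ξ : ℂ) - k‖ := by
    -- In the left half-plane `|ξ - k| ≥ |k|`; in the right one `|ξ - k| ≥ |Im k|`, which controls
    -- `Re k` by the sector condition.
    rcases le_or_gt k.re 0 with h | h
    · have : ‖k‖ ≤ ‖(ξ : ℂ) - k‖ := by
        rw [← sq_le_sq₀ (norm_nonneg _) (norm_nonneg _), Complex.sq_norm, Complex.sq_norm,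
          Complex.normSq_apply, Complex.normSq_apply]
        simp only [Complex.sub_re, Complex.sub_im, Complex.ofReal_re, Complex.ofReal_im]
        nlinarith
      nlinarith [norm_nonneg ((ξ : ℂ) - k)]
    · have h2 : |k.im| ≤ ‖(ξ : ℂ) - k‖ := by
        simpa using Complex.abs_im_le_norm ((ξ : ℂ) - k)
      have h3 : k.re ≤ t⁻¹ * |k.im| := by
        rw [inv_mul_eq_div, le_div_iff₀ ht]; linarith
      have h4 := Complex.norm_le_abs_re_add_abs_im k
      rw [abs_of_pos h] at h4
      nlinarith
  have h2 : ξ ≤ ‖(ξ : ℂ) - k‖ + ‖k‖ := by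
    have := norm_add_le ((ξ : ℂ) - k) k
    rw [sub_add_cancel, Complex.norm_real, Real.norm_of_nonneg hξ] at this
    exact this
  linarith

/-- `1 / (2πη - k)` for `η > 0`, and zero otherwise. -/
noncomputable def resolventSymbol (k : ℂ) (η : ℝ) : ℂ :=
  (Ioi (0 : ℝ)).indicator (fun ξ : ℝ => 1 / ((ξ : ℂ) - k)) (2 * Real.pi * η)

theorem measurable_resolventSymbol (k : ℂ) : Measurable (resolventSymbol k) := by
  have h : Measurable (fun ξ : ℝ => 1 / ((ξ : ℂ) - k)) := by fun_prop
  exact (h.indicator measurableSet_Ioi).comp (measurable_const_mul _)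

theorem memLp_one_add_abs_rpow :
    MemLp (fun η : ℝ => (1 + ‖η‖) ^ (-(3 / 4) : ℝ)) 2 volume := by
  have hm : AEStronglyMeasurable (fun η : ℝ => (1 + ‖η‖) ^ (-(3 / 4) : ℝ)) volume :=
    Measurable.aestronglyMeasurable (by fun_prop)
  rw [memLp_two_iff_integrable_sq hm]
  have := integrable_one_add_norm (E := ℝ) (μ := volume) (r := 3 / 2) (by norm_num)
  refine this.congr (Filter.Eventually.of_forall fun η => ?_)
  simp only
  rw [← Real.rpow_natCast, ← Real.rpow_mul (by positivity)]
  norm_num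

section

variable {k : ℂ} {D : ℝ}

/-- Both `|k|` and `1 + η` are at most `S = 2πη + |k|`; split `S = S^{1/4} S^{3/4}`. The exponent
`3/4 > 1/2` gives square integrability and leaves a negative power of `|k|`. -/
theorem norm_resolventSymbol_le (hD : 0 < D)
    (hk : ∀ ξ : ℝ, 0 ≤ ξ → ξ + ‖k‖ ≤ D * ‖(ξ : ℂ) - k‖) (hk1 : 1 ≤ ‖k‖) (η : ℝ) :
    ‖resolventSymbol k η‖ ≤ D * ‖k‖ ^ (-(1 / 4) : ℝ) * (1 + ‖η‖) ^ (-(3 / 4) : ℝ) := by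
  unfold resolventSymbol
  by_cases hη : 2 * Real.pi * η ∈ Ioi (0 : ℝ)
  swap
  · rw [indicator_of_notMem hη, norm_zero]; positivity
  rw [indicator_of_mem hη]
  have hη0 : 0 < η := pos_of_mul_pos_right hη (by positivity)
  set S : ℝ := 2 * Real.pi * η + ‖k‖ with hS
  have h1 := hk _ (le_of_lt hη)
  have hS0 : 0 < S := by have : (0:ℝ) < 2 * Real.pi * η := hη; positivity
  have hkS : ‖k‖ ≤ S := by have : (0:ℝ) < 2 * Real.pi * η := hη; linarith
  have hηS : 1 + ‖η‖ ≤ S := by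
    rw [Real.norm_of_nonneg hη0.le]; nlinarith [Real.pi_gt_three]
  have h2 : ‖k‖ ^ (1 / 4 : ℝ) * (1 + ‖η‖) ^ (3 / 4 : ℝ) ≤ S := by
    calc _ ≤ S ^ (1 / 4 : ℝ) * S ^ (3 / 4 : ℝ) := by gcongr
      _ = S := by rw [← Real.rpow_add hS0]; norm_num
  have h3 : 0 < ‖((2 * Real.pi * η : ℝ) : ℂ) - k‖ := by
    by_contra h
    have : ‖((2 * Real.pi * η : ℝ) : ℂ) - k‖ = 0 := le_antisymm (not_lt.1 h) (norm_nonneg _)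
    rw [this] at h1
    linarith
  rw [norm_div, norm_one, Real.rpow_neg (norm_nonneg k), Real.rpow_neg (by positivity), mul_assoc D,
    ← mul_inv, ← div_eq_mul_inv, div_le_div_iff₀ h3 (by positivity)]
  linarith

theorem memLp_resolventSymbol (hD : 0 < D)
    (hk : ∀ ξ : ℝ, 0 ≤ ξ → ξ + ‖k‖ ≤ D * ‖(ξ : ℂ) - k‖) (hk1 : 1 ≤ ‖k‖) :
    MemLp (resolventSymbol k) 2 volume :=
  memLp_one_add_abs_rpow.of_le_mul (measurable_resolventSymbol k).aestronglyMeasurable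
    (c := D * ‖k‖ ^ (-(1 / 4) : ℝ)) (Filter.Eventually.of_forall fun η => by
      rw [Real.norm_of_nonneg (by positivity : (0 : ℝ) ≤ (1 + ‖η‖) ^ (-(3 / 4) : ℝ))]
      exact norm_resolventSymbol_le hD hk hk1 η)

theorem kernelG_eq (h : MemLp (resolventSymbol k) 2 volume) :
    kernelG k = (𝓕⁻ (h.toLp _) : Lp ℂ 2 (volume : Measure ℝ)) := by
  unfold kernelG fourierInvL2
  exact dif_pos h

theorem _root_.MeasureTheory.Lp.norm_fourierInv_eq (f : Lp ℂ 2 (volume : Measure ℝ)) :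
    ‖(𝓕⁻ f : Lp ℂ 2 (volume : Measure ℝ))‖ = ‖f‖ :=
  (Lp.fourierTransformₗᵢ ℝ ℂ).symm.norm_map f

theorem toReal_eLpNorm_kernelG_le (hD : 0 < D)
    (hk : ∀ ξ : ℝ, 0 ≤ ξ → ξ + ‖k‖ ≤ D * ‖(ξ : ℂ) - k‖) (hk1 : 1 ≤ ‖k‖) :
    (eLpNorm (kernelG k) 2 volume).toReal ≤ D * ‖k‖ ^ (-(1 / 4) : ℝ) *
      (eLpNorm (fun η : ℝ => (1 + ‖η‖) ^ (-(3 / 4) : ℝ)) 2 volume).toReal := by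
  have hm := memLp_resolventSymbol hD hk hk1
  rw [kernelG_eq hm, ← Lp.norm_def, Lp.norm_fourierInv_eq, Lp.norm_toLp]
  have h : eLpNorm (resolventSymbol k) 2 volume ≤ ENNReal.ofReal (D * ‖k‖ ^ (-(1 / 4) : ℝ)) *
      eLpNorm (fun η : ℝ => (1 + ‖η‖) ^ (-(3 / 4) : ℝ)) 2 volume :=
    eLpNorm_le_mul_eLpNorm_of_ae_le_mul (Filter.Eventually.of_forall fun η => by
      rw [Real.norm_of_nonneg (by positivity : (0 : ℝ) ≤ (1 + ‖η‖) ^ (-(3 / 4) : ℝ))]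
      exact norm_resolventSymbol_le hD hk hk1 η) 2
  have := ENNReal.toReal_mono
    (ENNReal.mul_ne_top ENNReal.ofReal_ne_top memLp_one_add_abs_rpow.2.ne) h
  rwa [ENNReal.toReal_mul, ENNReal.toReal_ofReal (by positivity)] at this

/-- Membership of `f̂` in `L²_s` makes `w^θ f̂` integrable for `θ < s - 1/2`. -/
theorem integrable_weight_rpow_mul {s θ : ℝ} {f : ℝ → ℂ} (hf : MemWeightedLp 2 s f)
    (hθ : θ < s - 1 / 2) : Integrable (fun ξ => weight ξ ^ θ * ‖f ξ‖) := by
  -- Square integrability of `w^{θ-s}` amounts to `2(s - θ) > 1`; Hölder then concludes.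
  have hw : MemLp (fun ξ => weight ξ ^ (θ - s)) 2 volume := by
    rw [memLp_two_iff_integrable_sq (continuous_weight_rpow _).aestronglyMeasurable]
    have := integrable_one_add_norm (E := ℝ) (μ := volume) (r := 2 * (s - θ))
      (by simp; linarith)
    refine this.congr (Filter.Eventually.of_forall fun η => ?_)
    simp only [Real.norm_eq_abs]
    rw [← Real.rpow_natCast, ← Real.rpow_mul (weight_pos _).le]
    unfold weight
    congr 1
    push_cast
    ring
  have := memLp_one_iff_integrable.1 (MemLp.mul' (p := 2) (q := 2) (r := 1) hf.norm hw)
  refine this.congr (Filter.Eventually.of_forall fun ξ => ?_)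
  simp only
  rw [norm_mul, norm_weight_rpow, ← mul_assoc, ← Real.rpow_add (weight_pos _)]
  congr 2
  ring

end

/-! ### `T_k 1` and `C₊ u` as Fourier integrals -/

section

variable {k : ℂ} {u : ℝ → ℂ}

theorem fourierL2_two_pi_mul (hu : MemLp u 2 volume) (η : ℝ) :
    fourierL2 u (2 * Real.pi * η) = (𝓕 (hu.toLp u) : Lp ℂ 2 (volume : Measure ℝ)) η := by
  unfold fourierL2
  rw [dif_pos hu]
  congr 1
  field_simp

theorem opT_one_eq (hu : MemLp u 2 volume) (hr : MemLp (resolventSymbol k) 2 volume) (x : ℝ) :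
    opT u k (fun _ => 1) x = ∫ η, (Real.fourierChar (η * x) : ℂ) * resolventSymbol k η *
      fourierL2 u (2 * Real.pi * η) := by
  have h := integral_fourierInv_sub_mul (hr.toLp _) (hu.toLp u) x
  rw [← kernelG_eq hr] at h
  simp only [fourierL2_two_pi_mul hu, opT, mul_one]
  have e1 : ∫ y, kernelG k (x - y) * u y = ∫ y, kernelG k (x - y) * hu.toLp u y :=
    integral_congr_ae (hu.coeFn_toLp.mono fun y hy => by simp only [hy])
  rw [e1, h]
  exact integral_congr_ae (hr.coeFn_toLp.mono fun y hy => by simp only [hy])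

theorem indicator_Ioi_two_pi_mul (f : ℝ → ℂ) :
    (fun η : ℝ => (Ioi (0 : ℝ)).indicator f (2 * Real.pi * η)) =
    (Ioi (0 : ℝ)).indicator (fun η => f (2 * Real.pi * η)) := by
  ext η
  have : 2 * Real.pi * η ∈ Ioi (0 : ℝ) ↔ η ∈ Ioi (0 : ℝ) := by
    simp only [mem_Ioi]
    exact mul_pos_iff_of_pos_left (by positivity)
  by_cases h : η ∈ Ioi (0 : ℝ)
  · rw [indicator_of_mem h, indicator_of_mem (this.2 h)]
  · rw [indicator_of_notMem h, indicator_of_notMem (mt this.1 h)]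

theorem cauchyPlus_ae_eq (hu : MemLp u 2 volume)
    (hi : Integrable (fun η => fourierL2 u (2 * Real.pi * η))) :
    cauchyPlus u =ᵐ[volume] fun x => ∫ η, (Real.fourierChar (η * x) : ℂ) *
      (Ioi (0 : ℝ)).indicator (fourierL2 u) (2 * Real.pi * η) := by
  have hset := indicator_Ioi_two_pi_mul (fourierL2 u)
  have h2 : MemLp (fun η => fourierL2 u (2 * Real.pi * η)) 2 volume := by
    simp only [fourierL2_two_pi_mul hu]
    exact Lp.memLp _
  have hm2 : MemLp (fun η : ℝ => (Ioi (0 : ℝ)).indicator (fourierL2 u) (2 * Real.pi * η))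
      2 volume := by
    rw [hset]; exact h2.indicator measurableSet_Ioi
  have hm1 : Integrable (fun η : ℝ => (Ioi (0 : ℝ)).indicator (fourierL2 u) (2 * Real.pi * η)) := by
    rw [hset]; exact hi.indicator measurableSet_Ioi
  have e : cauchyPlus u = (𝓕⁻ (hm2.toLp _) : Lp ℂ 2 (volume : Measure ℝ)) := by
    unfold cauchyPlus fourierInvL2
    exact dif_pos hm2
  rw [e]
  filter_upwards [fourierInv_toLp_ae_eq hm1 hm2] with x hx
  rw [hx, Real.fourierInv_eq]
  congr 1; ext η
  rw [Circle.smul_def, smul_eq_mul]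
  congr 3
  simp [mul_comm]

variable {D θ : ℝ}

theorem norm_sub_pos_of_sector (hk : ∀ ξ : ℝ, 0 ≤ ξ → ξ + ‖k‖ ≤ D * ‖(ξ : ℂ) - k‖)
    (hk1 : 1 ≤ ‖k‖) {ξ : ℝ} (hξ : 0 ≤ ξ) : 0 < ‖(ξ : ℂ) - k‖ := by
  refine (norm_nonneg _).lt_of_ne fun h => ?_
  have := hk ξ hξ
  rw [← h] at this
  linarith

/-- The factor `w^θ ≥ 1` is a harmless loss that lets one integral of `w^θ |û|` serve here and in
the next estimate. -/
theorem norm_one_div_sub_le (hD : 0 < D)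
    (hk : ∀ ξ : ℝ, 0 ≤ ξ → ξ + ‖k‖ ≤ D * ‖(ξ : ℂ) - k‖) (hk1 : 1 ≤ ‖k‖) (hθ : 0 ≤ θ)
    {ξ : ℝ} (hξ : 0 ≤ ξ) : ‖1 / ((ξ : ℂ) - k)‖ ≤ D * ‖k‖⁻¹ * weight ξ ^ θ := by
  have h3 := norm_sub_pos_of_sector hk hk1 hξ
  have h1 : ‖1 / ((ξ : ℂ) - k)‖ ≤ D * ‖k‖⁻¹ := by
    rw [norm_div, norm_one, ← div_eq_mul_inv, div_le_div_iff₀ h3 (by positivity)]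
    linarith [hk ξ hξ]
  exact h1.trans (le_mul_of_one_le_right (by positivity) (Real.one_le_rpow (one_le_weight ξ) hθ))

/-- The sum equals `ξ / (k (ξ - k))`. Writing `ξ = ξ^θ ξ^{1-θ}`, the first factor is charged to the
weight and the second to `(ξ + |k|)^{1-θ}`, which gains `|k|^{-θ}`. -/
theorem norm_one_div_sub_add_one_div_le (hD : 0 < D)
    (hk : ∀ ξ : ℝ, 0 ≤ ξ → ξ + ‖k‖ ≤ D * ‖(ξ : ℂ) - k‖) (hk1 : 1 ≤ ‖k‖) (hθ : 0 ≤ θ)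
    (hθ1 : θ ≤ 1) {ξ : ℝ} (hξ : 0 ≤ ξ) :
    ‖1 / ((ξ : ℂ) - k) + 1 / k‖ ≤ D * ‖k‖ ^ (-(1 + θ)) * weight ξ ^ θ := by
  have h3 := norm_sub_pos_of_sector hk hk1 hξ
  have hk0 : 0 < ‖k‖ := by linarith
  have e : 1 / ((ξ : ℂ) - k) + 1 / k = ξ / (k * (ξ - k)) := by
    have h4 : (ξ : ℂ) - k ≠ 0 := norm_pos_iff.1 h3
    have h5 : k ≠ 0 := norm_pos_iff.1 hk0
    field_simp
    ring
  have hS0 : 0 < ξ + ‖k‖ := by linarith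
  have h1 : ξ * ‖k‖ ^ θ ≤ (ξ + ‖k‖) * weight ξ ^ θ := by
    have hw : ξ ≤ weight ξ := by unfold weight; linarith [le_abs_self ξ]
    calc ξ * ‖k‖ ^ θ = ξ ^ θ * (ξ ^ (1 - θ) * ‖k‖ ^ θ) := by
          rw [← mul_assoc, ← Real.rpow_add_of_nonneg hξ hθ (by linarith)]
          simp
      _ ≤ weight ξ ^ θ * ((ξ + ‖k‖) ^ (1 - θ) * (ξ + ‖k‖) ^ θ) := by
          gcongr
          · exact Real.rpow_nonneg (weight_pos ξ).le θ
          · linarith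
          · linarith
      _ = (ξ + ‖k‖) * weight ξ ^ θ := by
          rw [← Real.rpow_add hS0]; simp [mul_comm]
  rw [e, norm_div, norm_mul, Complex.norm_real, Real.norm_of_nonneg hξ, Real.rpow_neg hk0.le,
    Real.rpow_add hk0, Real.rpow_one, div_le_iff₀ (by positivity)]
  have hkp : 0 < ‖k‖ ^ θ := Real.rpow_pos_of_pos hk0 θ
  have e2 : D * (‖k‖ * ‖k‖ ^ θ)⁻¹ * weight ξ ^ θ * (‖k‖ * ‖(ξ : ℂ) - k‖) =
      (D * ‖(ξ : ℂ) - k‖) * weight ξ ^ θ / ‖k‖ ^ θ := by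
    field_simp
  rw [e2, le_div_iff₀ hkp]
  exact h1.trans (mul_le_mul_of_nonneg_right (hk ξ hξ) (Real.rpow_nonneg (weight_pos ξ).le θ))

/-- A Fourier integral over the half-line, with a multiplier bounded by `c w^θ`. -/
theorem norm_integral_fourierChar_mul_indicator_le {f q : ℝ → ℂ} {c : ℝ}
    (hi : Integrable (fun η => weight (2 * Real.pi * η) ^ θ * ‖f (2 * Real.pi * η)‖)) (hc : 0 ≤ c)
    (hq : ∀ ξ, 0 ≤ ξ → ‖q ξ‖ ≤ c * weight ξ ^ θ) (x : ℝ) :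
    ‖∫ η, (Real.fourierChar (η * x) : ℂ) *
      (Ioi (0 : ℝ)).indicator (fun ξ => q ξ * f ξ) (2 * Real.pi * η)‖ ≤
      c * ∫ η, weight (2 * Real.pi * η) ^ θ * ‖f (2 * Real.pi * η)‖ := by
  rw [← integral_const_mul]
  refine norm_integral_le_of_norm_le (hi.const_mul c) (Filter.Eventually.of_forall fun η => ?_)
  rw [norm_mul, Circle.norm_coe, one_mul]
  by_cases h : 2 * Real.pi * η ∈ Ioi (0 : ℝ)
  · rw [indicator_of_mem h, norm_mul, ← mul_assoc]
    exact mul_le_mul_of_nonneg_right (hq _ (le_of_lt h)) (norm_nonneg _)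
  · rw [indicator_of_notMem h, norm_zero]
    have := Real.rpow_nonneg (weight_pos (2 * Real.pi * η)).le θ
    positivity

theorem norm_opT_one_le (hD : 0 < D) (hu : MemLp u 2 volume)
    (hk : ∀ ξ : ℝ, 0 ≤ ξ → ξ + ‖k‖ ≤ D * ‖(ξ : ℂ) - k‖) (hk1 : 1 ≤ ‖k‖) (hθ : 0 ≤ θ)
    (hi : Integrable
      (fun η => weight (2 * Real.pi * η) ^ θ * ‖fourierL2 u (2 * Real.pi * η)‖)) (x : ℝ) :
    ‖opT u k (fun _ => 1) x‖ ≤ D * ‖k‖⁻¹ *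
      ∫ η, weight (2 * Real.pi * η) ^ θ * ‖fourierL2 u (2 * Real.pi * η)‖ := by
  rw [opT_one_eq hu (memLp_resolventSymbol hD hk hk1)]
  refine le_trans (le_of_eq ?_) (norm_integral_fourierChar_mul_indicator_le hi (by positivity)
    (fun ξ hξ => norm_one_div_sub_le hD hk hk1 hθ hξ) x)
  congr 2; ext η
  rw [mul_assoc, resolventSymbol, ← indicator_mul_left]

theorem norm_opT_one_add_cauchyPlus_le (hD : 0 < D) (hu : MemLp u 2 volume)
    (hk : ∀ ξ : ℝ, 0 ≤ ξ → ξ + ‖k‖ ≤ D * ‖(ξ : ℂ) - k‖) (hk1 : 1 ≤ ‖k‖) (hθ : 0 ≤ θ)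
    (hθ1 : θ ≤ 1) (hi : Integrable
      (fun η => weight (2 * Real.pi * η) ^ θ * ‖fourierL2 u (2 * Real.pi * η)‖)) :
    ∀ᵐ x, ‖opT u k (fun _ => 1) x + cauchyPlus u x / k‖ ≤ D * ‖k‖ ^ (-(1 + θ)) *
      ∫ η, weight (2 * Real.pi * η) ^ θ * ‖fourierL2 u (2 * Real.pi * η)‖ := by
  have hr := memLp_resolventSymbol hD hk hk1
  have hF : MemLp (fun η => fourierL2 u (2 * Real.pi * η)) 2 volume := by
    simp only [fourierL2_two_pi_mul hu]
    exact Lp.memLp _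
  have hF1 : Integrable (fun η => fourierL2 u (2 * Real.pi * η)) :=
    hi.mono hF.1 (Filter.Eventually.of_forall fun η => by
      rw [norm_mul, norm_norm, Real.norm_of_nonneg (Real.rpow_nonneg (weight_pos _).le θ)]
      exact le_mul_of_one_le_left (norm_nonneg _) (Real.one_le_rpow (one_le_weight _) hθ))
  filter_upwards [cauchyPlus_ae_eq hu hF1] with x hx
  rw [hx, opT_one_eq hu hr, div_eq_mul_inv, ← integral_mul_const, ← integral_add]
  · refine le_trans (le_of_eq ?_) (norm_integral_fourierChar_mul_indicator_le hi (by positivity)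
      (fun ξ hξ => norm_one_div_sub_add_one_div_le hD hk hk1 hθ hθ1 hξ) x)
    congr 2; ext η
    rw [resolventSymbol]
    by_cases h : 2 * Real.pi * η ∈ Ioi (0 : ℝ)
    · simp only [indicator_of_mem h]; ring
    · simp only [indicator_of_notMem h]; ring
  · exact memLp_one_iff_integrable.1
      (MemLp.mul' (p := 2) (q := 2) hF (memLp_fourierChar_mul hr x))
  · refine Integrable.mul_const ?_ _
    have h1 : Integrable
        (fun η : ℝ => (Ioi (0 : ℝ)).indicator (fourierL2 u) (2 * Real.pi * η)) := by
      rw [indicator_Ioi_two_pi_mul]; exact hF1.indicator measurableSet_Ioi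
    exact memLp_one_iff_integrable.1 (memLp_fourierChar_mul (memLp_one_iff_integrable.2 h1) x)

end

/-! ### Jost solutions: uniqueness and first-order expansion -/

section

variable {s : ℝ} {u : ℝ → ℂ} {k : ℂ}

/-- Since `s₁ > 0`, every admissible space embeds in `L^∞_{-s}`, so solutions with different `s₁`
can be compared. -/
theorem IsJostSolution.exists_bound {m : ℝ → ℂ} (h : IsJostSolution s u k m) :
    AEStronglyMeasurable m volume ∧ ∃ B, 0 ≤ B ∧ ∀ᵐ x, ‖m x‖ ≤ B * weight x ^ s := by
  obtain ⟨s₁, h1, h2, hm⟩ := h.mem_space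
  refine ⟨hm.aestronglyMeasurable,
    (eLpNorm (fun x : ℝ => ((weight x ^ (-(s - s₁)) : ℝ) : ℂ) * m x) ∞ volume).toReal,
    ENNReal.toReal_nonneg, ?_⟩
  filter_upwards [ae_norm_le_toReal_eLpNorm_top hm] with x hx
  rw [norm_mul, norm_weight_rpow, Real.rpow_neg (weight_pos x).le,
    inv_mul_le_iff₀ (Real.rpow_pos_of_pos (weight_pos x) _)] at hx
  rw [mul_comm]
  refine hx.trans (mul_le_mul_of_nonneg_right ?_ ENNReal.toReal_nonneg)
  exact Real.rpow_le_rpow_of_exponent_le (one_le_weight x) (by linarith)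

theorem isJostSolution_of_bounded (hs : 1 / 2 < s) {m : ℝ → ℂ} {B : ℝ}
    (hm : AEStronglyMeasurable m volume) (hB : ∀ᵐ x, ‖m x‖ ≤ B)
    (h : ∀ᵐ x, m x = 1 + opT u k m x) : IsJostSolution s u k m := by
  -- Any `s₁` strictly between `1/2` and `s` would do; this is the midpoint.
  refine ⟨⟨(s + 1 / 2) / 2, by linarith, by linarith, ?_⟩, h⟩
  refine MemLp.of_le (memLp_top_of_bound hm B hB) ?_ (Filter.Eventually.of_forall fun x => ?_)
  · exact (Complex.continuous_ofReal.comp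
      (continuous_weight_rpow _)).aestronglyMeasurable.mul hm
  · rw [norm_mul, norm_weight_rpow]
    exact mul_le_of_le_one_left (norm_nonneg _)
      (Real.rpow_le_one_of_one_le_of_nonpos (one_le_weight x) (by linarith))

theorem IsJostSolution.ae_eq (hs : 0 ≤ s) (hu : MemWeightedLp 2 s u)
    (hN : opTBound s u k ≤ 1 / 2) {m m' : ℝ → ℂ} (h : IsJostSolution s u k m)
    (h' : IsJostSolution s u k m') : m =ᵐ[volume] m' := by
  obtain ⟨hm, B, hB0, hB⟩ := h.exists_bound
  obtain ⟨hm', B', hB0', hB'⟩ := h'.exists_bound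
  -- The difference solves the homogeneous equation, so `A = 0` forces it to vanish.
  have key := ae_norm_le_two_mul_of_le_add_opT (φ := fun y => m y - m' y) (k := k) (A := 0)
    (M := B + B') hs hu hN le_rfl (hm.sub hm') (by positivity) ?_ ?_
  · filter_upwards [key] with x hx
    rw [mul_zero, norm_le_zero_iff] at hx
    exact sub_eq_zero.1 hx
  · filter_upwards [hB, hB'] with x h1 h2
    exact (norm_sub_le _ _).trans (by linarith)
  · filter_upwards [h.integral_eq, h'.integral_eq] with x h1 h2
    rw [opT_sub hu hm hB hm' hB', zero_add, h1, h2, add_sub_add_left_eq_sub]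

/-- The first order expansion of a bounded Jost function. -/
theorem ae_norm_sub_one_sub_opT_one_le (hs : 0 ≤ s) (hu : MemWeightedLp 2 s u)
    (hN : opTBound s u k ≤ 1 / 2) {m : ℝ → ℂ} {A : ℝ} (hA : 0 ≤ A)
    (hT : ∀ x, ‖opT u k (fun _ => 1) x‖ ≤ A) (h : IsJostSolution s u k m) :
    ∀ᵐ x, ‖m x - 1 - opT u k (fun _ => 1) x‖ ≤ opTBound s u k * (2 * A) := by
  obtain ⟨hm, B, hB0, hB⟩ := h.exists_bound
  have h1 : ∀ᵐ y : ℝ, ‖(fun _ : ℝ => (1 : ℂ)) y‖ ≤ 1 * weight y ^ s :=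
    Filter.Eventually.of_forall fun y => le_mul_weight_of_le hs zero_le_one (by simp) y
  have hn : AEStronglyMeasurable (fun y => m y - 1) volume := hm.sub aestronglyMeasurable_const
  -- Subtracting `1 + T_k 1` from the equation leaves `T_k (m - 1)`.
  have e : ∀ᵐ x, m x - 1 - opT u k (fun _ => 1) x = opT u k (fun y => m y - 1) x := by
    filter_upwards [h.integral_eq] with x hx
    rw [opT_sub hu hm hB aestronglyMeasurable_const h1, hx]
    ring
  have key := ae_norm_le_two_mul_of_le_add_opT (φ := fun y => m y - 1) (k := k) (A := A)
    (M := B + 1) hs hu hN hA hn (by positivity) ?_ ?_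
  · filter_upwards [e] with x hx
    rw [hx]
    exact norm_opT_le hu hn (by positivity)
      (key.mono fun y hy => le_mul_weight_of_le hs (by positivity) hy y) x
  · filter_upwards [hB, h1] with x h1 h2
    exact (norm_sub_le _ _).trans (by linarith)
  · filter_upwards [e] with x hx
    rw [← hx]
    have := norm_sub_norm_le (m x - 1) (opT u k (fun _ => 1) x)
    linarith [hT x]

end

end BenjaminOno

/-! ### Choice of constants and conclusion -/

open BenjaminOno in
theorem theorem6p4 (s : ℝ) (hs : 1 / 2 < s) (u : ℝ → ℂ)
    (hu : BenjaminOno.MemWeightedSobolev s u)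
    (α : ℝ) (hα₀ : 0 < α) (hα₁ : α < Real.pi / 2) :
    ∃ ε : ℝ, 0 < ε ∧ ∃ C : ℝ, 0 < C ∧ ∃ k₀ : ℝ, 0 < k₀ ∧
      ∀ k : ℂ, Real.tan α * k.re < |k.im| → k₀ < ‖k‖ →
        ∃ m₁ : ℝ → ℂ,
          BenjaminOno.IsJostSolution s u k m₁ ∧
          (∀ m : ℝ → ℂ, BenjaminOno.IsJostSolution s u k m → m =ᵐ[volume] m₁) ∧
          eLpNorm (fun x : ℝ => m₁ x - (1 - BenjaminOno.cauchyPlus u x / k)) ∞ volume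
            ≤ ENNReal.ofReal (C * ‖k‖ ^ (-(1 + ε))) := by
  obtain ⟨D, hD, hsec⟩ := exists_add_norm_le_mul_norm_sub
    (Real.tan_pos_of_pos_of_lt_pi_div_two hα₀ hα₁)
  have hs0 : 0 ≤ s := by linarith
  have hu2 : MemLp u 2 volume := hu.1.memLp hs0
  -- The interpolation of the symbol needs `θ ≤ 1`; integrability of `w^θ û` needs `θ < s - 1/2`.
  obtain ⟨θ, hθ, hθ1, hθs⟩ : ∃ θ : ℝ, 0 < θ ∧ θ ≤ 1 ∧ θ < s - 1 / 2 :=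
    ⟨min 1 ((s - 1 / 2) / 2), by rw [lt_min_iff]; constructor <;> linarith, min_le_left _ _,
      (min_le_right _ _).trans_lt (by linarith)⟩
  have hi : Integrable
      (fun η => weight (2 * Real.pi * η) ^ θ * ‖fourierL2 u (2 * Real.pi * η)‖) :=
    (integrable_weight_rpow_mul hu.2 hθs).comp_mul_left' (by positivity)
  set I := ∫ η, weight (2 * Real.pi * η) ^ θ * ‖fourierL2 u (2 * Real.pi * η)‖ with hI
  have hI0 : 0 ≤ I := integral_nonneg fun η =>
    mul_nonneg (Real.rpow_nonneg (weight_pos _).le _) (norm_nonneg _)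
  set E := D * (eLpNorm (fun η : ℝ => (1 + ‖η‖) ^ (-(3 / 4) : ℝ)) 2 volume).toReal *
    (eLpNorm (fun x : ℝ => ((weight x ^ s : ℝ) : ℂ) * u x) 2 volume).toReal with hE
  have hE0 : 0 ≤ E := by positivity
  -- The two errors decay like `|k|^{-5/4}` and `|k|^{-1-θ}`, with constants `2DIE` and `DI`; the `+
  -- 1` ensures `C > 0`. The threshold `(2E + 1)^4` gives `|k| ≥ 1` and `E |k|^{-1/4} ≤ 1/2`.
  refine ⟨min θ (1 / 4), by positivity, 2 * D * I * E + D * I + 1, by positivity,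
    (2 * E + 1) ^ (4 : ℝ), by positivity, fun k hk hk0 => ?_⟩
  have hk1 : 1 ≤ ‖k‖ := le_trans (Real.one_le_rpow (by linarith) (by norm_num)) hk0.le
  have hkp : 0 < ‖k‖ := by linarith
  have hkD := hsec k hk
  have hNE : opTBound s u k ≤ E * ‖k‖ ^ (-(1 / 4) : ℝ) := by
    have := mul_le_mul_of_nonneg_right (toReal_eLpNorm_kernelG_le hD hkD hk1)
      (ENNReal.toReal_nonneg
        (a := eLpNorm (fun x : ℝ => ((weight x ^ s : ℝ) : ℂ) * u x) 2 volume))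
    rw [opTBound]
    refine this.trans (le_of_eq ?_)
    rw [hE]; ring
  have hN : opTBound s u k ≤ 1 / 2 := by
    refine hNE.trans ?_
    have h1 : 2 * E + 1 ≤ ‖k‖ ^ (1 / 4 : ℝ) := by
      have := Real.rpow_le_rpow (by positivity) hk0.le (by norm_num : (0 : ℝ) ≤ 1 / 4)
      rwa [← Real.rpow_mul (by positivity), show (4 : ℝ) * (1 / 4) = 1 by norm_num,
        Real.rpow_one] at this
    rw [Real.rpow_neg hkp.le, ← div_eq_mul_inv, div_le_iff₀ (by positivity)]
    linarith
  obtain ⟨m, B, hm, -, hB, hfix⟩ := exists_bounded_fixedPoint hs0 hu.1 hN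
  have hJ := isJostSolution_of_bounded hs hm hB hfix
  refine ⟨m, hJ, fun m' hm' => hm'.ae_eq hs0 hu.1 hN hJ, ?_⟩
  rw [eLpNorm_exponent_top]
  refine eLpNormEssSup_le_of_ae_bound ?_
  filter_upwards [ae_norm_sub_one_sub_opT_one_le hs0 hu.1 hN (by positivity)
    (norm_opT_one_le hD hu2 hkD hk1 hθ.le hi) hJ,
    norm_opT_one_add_cauchyPlus_le hD hu2 hkD hk1 hθ.le hθ1 hi] with x h1 h2
  rw [← hI] at h1 h2
  have e : m x - (1 - cauchyPlus u x / k) = (m x - 1 - opT u k (fun _ => 1) x) +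
      (opT u k (fun _ => 1) x + cauchyPlus u x / k) := by ring
  have h3 : ‖k‖ ^ (-(1 / 4) : ℝ) * ‖k‖⁻¹ ≤ ‖k‖ ^ (-(1 + min θ (1 / 4))) := by
    rw [← Real.rpow_neg_one, ← Real.rpow_add hkp]
    exact Real.rpow_le_rpow_of_exponent_le hk1 (by linarith [min_le_right θ (1 / 4)])
  have h4 : ‖k‖ ^ (-(1 + θ)) ≤ ‖k‖ ^ (-(1 + min θ (1 / 4))) :=
    Real.rpow_le_rpow_of_exponent_le hk1 (by linarith [min_le_left θ (1 / 4)])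
  have h5 : 0 ≤ ‖k‖ ^ (-(1 + min θ (1 / 4))) := by positivity
  rw [e]
  calc _ ≤ _ := norm_add_le _ _
    _ ≤ (E * ‖k‖ ^ (-(1 / 4) : ℝ)) * (2 * (D * ‖k‖⁻¹ * I)) + D * ‖k‖ ^ (-(1 + θ)) * I := by
        refine add_le_add (h1.trans (mul_le_mul_of_nonneg_right hNE (by positivity))) h2
    _ = (2 * D * I * E) * (‖k‖ ^ (-(1 / 4) : ℝ) * ‖k‖⁻¹) + (D * I) * ‖k‖ ^ (-(1 + θ)) := by ring
    _ ≤ (2 * D * I * E) * ‖k‖ ^ (-(1 + min θ (1 / 4))) +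
        (D * I) * ‖k‖ ^ (-(1 + min θ (1 / 4))) := by gcongr
    _ ≤ _ := by linarith
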